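/- Let $v$ (visible) and $h$ (hidden) be finite-dimensional nonzero quantum systems, let $G_1,\dots,G_J$ be Hermitian operators on $v\otimes h$, and for $\theta\in\mathbb{R}^J$ set $$G(\theta)=\sum_{j=1}^J\theta_jG_j,\qquad Z(\theta)=\mathrm{Tr}[e^{-G(\theta)}],\qquad \sigma_{vh}(\theta)=\frac{e^{-G(\theta)}}{Z(\theta)},\qquad \sigma_v(\theta)=\mathrm{Tr}_h[\sigma_{vh}(\theta)].$$ Write $\langle A\rangle_\rho=\mathrm{Tr}[A\rho]$, $\{A,B\}=AB+BA$ and $D(\rho\|\sigma)=\mathrm{Tr}[\rho\ln\rho]-\mathrm{Tr}[\rho\ln\sigma]$ (with $0\ln 0=0$). Let $$\gamma(t)=\frac{2}{\pi}\ln\left|\coth\!\left(\frac{\pi t}{2}\right)\right|,\qquad \beta(t)=\frac{\pi}{2(\cosh(\pi t)+1)},$$ and define the maps $$\Upsilon_v^\theta(X)=\int_{-\infty}^{\infty}\beta(t)\,\sigma_v(\theta)^{-it/2}\,X\,\sigma_v(\theta)^{it/2}\,dt,$$ $$\Xi_{v\to vh}^\theta(R)=\tfrac12\left\{\sigma_{vh}(\theta),\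 \sigma_v(\theta)^{-1/2}R\,\sigma_v(\theta)^{-1/2}\otimes I_h\right\},$$ $$\Phi_{vh}^\theta(Y)=\int_{-\infty}^{\infty}\gamma(t)\,e^{-iG(\theta)t}\,Y\,e^{iG(\theta)t}\,dt,\qquad \Sigma_{v\to vh}^\theta=\Phi_{vh}^\theta\circ\Xi_{v\to vh}^\theta\circ\Upsilon_v^\theta .$$ Then for every $\theta\in\mathbb{R}^J$, every state $\rho$ of $v$ (positive semidefinite, unit trace) and every $j\in\{1,\dots,J\}$, the partial derivative of $D(\rho\|\sigma_v(\theta))$ with respect to $\theta_j$ exists and $$\frac{\partial}{\partial\theta_j}D(\rho\|\sigma_v(\theta))=\langle G_j\rangle_{\Sigma_{v\to vh}^\theta(\rho)}-\langle G_j\rangle_{\sigma_{vh}(\theta)}.$$ Moreover, $\Xi_{v\to vh}^\theta$ is a Hermiticity-preserving, trace-preserving linear map; $\Phi_{vh}^\theta$ and $\Upsilon_v^\theta$ are quantum channels (linear, completely positive and trace-preserving); and $\gamma$ and $\beta$ are probability density functions on $\mathbb{R}$. -/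

import Mathlib

open scoped Matrix Kronecker ComplexOrder

noncomputable section

namespace QBM

variable {v h n m : Type*} [Fintype v] [DecidableEq v] [Fintype h] [DecidableEq h]
  [Fintype n] [DecidableEq n] [Fintype m] [DecidableEq m]

/-- Quantum states: positive semidefinite matrices of unit trace. -/
structure IsState (ρ : Matrix n n ℂ) : Prop where
  posSemidef : ρ.PosSemidef
  trace_eq_one : ρ.trace = 1

/-- The expectation `⟨A⟩_ρ = Tr[A ρ]`. -/
def expect (A ρ : Matrix n n ℂ) : ℂ := (A * ρ).trace

/-- The anticommutator `{A, B} = A B + B A`. -/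
def anticomm (A B : Matrix n n ℂ) : Matrix n n ℂ := A * B + B * A

/-- The partial trace over the second (hidden) system. -/
def partialTrace (M : Matrix (v × h) (v × h) ℂ) : Matrix v v ℂ :=
  Matrix.of fun a b => ∑ k, M (a, k) (b, k)

/-- The logarithm of a Hermitian matrix, acting on its eigenvalues (with `ln 0 = 0`, which
implements the convention `0 ln 0 = 0` in `Tr[ρ ln ρ]`). -/
def matLog (A : Matrix n n ℂ) : Matrix n n ℂ := cfc Real.log A

/-- The complex power `A ^ z = exp (z ln A)` of a positive definite matrix `A`. -/
def matPow (A : Matrix n n ℂ) (z : ℂ) : Matrix n n ℂ := NormedSpace.exp (z • matLog A)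

/-- The Umegaki relative entropy `D(ρ‖σ) = Tr[ρ ln ρ] - Tr[ρ ln σ]`, for a state `ρ` and a
positive definite state `σ`. Both traces are real numbers, regarded here as elements of `ℂ`. -/
def relEntropy (ρ σ : Matrix n n ℂ) : ℂ := (ρ * matLog ρ).trace - (ρ * matLog σ).trace

/-- The integral of a matrix-valued function over the real line (entry by entry). -/
def matIntegral (F : ℝ → Matrix n n ℂ) : Matrix n n ℂ :=
  Matrix.of fun a b => ∫ t : ℝ, F t a b

/-- Probability density functions on the real line. -/
structure IsProbDensity (f : ℝ → ℝ) : Prop where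
  nonneg : ∀ t, 0 ≤ f t
  integrable : MeasureTheory.Integrable f
  integral_eq_one : ∫ t : ℝ, f t = 1

/-- The high-peak tent density `γ(t) = (2 / π) ln |coth (π t / 2)|`. -/
def tentDensity (t : ℝ) : ℝ :=
  2 / Real.pi * Real.log |Real.cosh (Real.pi * t / 2) / Real.sinh (Real.pi * t / 2)|

/-- The logistic density `β(t) = π / (2 (cosh (π t) + 1))`. -/
def logisticDensity (t : ℝ) : ℝ := Real.pi / (2 * (Real.cosh (Real.pi * t) + 1))

/-- The parameterized Hamiltonian `G(θ) = ∑ j, θ j • G j`. -/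
def ham {J : ℕ} (G : Fin J → Matrix n n ℂ) (θ : Fin J → ℝ) : Matrix n n ℂ :=
  ∑ j, (θ j : ℂ) • G j

/-- The partition function `Z(θ) = Tr[e^{-G(θ)}]`. -/
def partitionFun {J : ℕ} (G : Fin J → Matrix n n ℂ) (θ : Fin J → ℝ) : ℂ :=
  (NormedSpace.exp (-ham G θ)).trace

/-- The thermal state `e^{-G(θ)} / Z(θ)`; for `n = v × h` it is `σ_vh(θ)`. -/
def thermalState {J : ℕ} (G : Fin J → Matrix n n ℂ) (θ : Fin J → ℝ) : Matrix n n ℂ :=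
  (partitionFun G θ)⁻¹ • NormedSpace.exp (-ham G θ)

/-- The visible marginal `σ_v(θ) = Tr_h[σ_vh(θ)]`. -/
def visibleState {J : ℕ} (G : Fin J → Matrix (v × h) (v × h) ℂ) (θ : Fin J → ℝ) :
    Matrix v v ℂ :=
  partialTrace (thermalState G θ)

/-- `Υ(X) = ∫ β(t) σ_v(θ)^{-it/2} X σ_v(θ)^{it/2} dt`. -/
def mapUpsilon {J : ℕ} (G : Fin J → Matrix (v × h) (v × h) ℂ) (θ : Fin J → ℝ)
    (X : Matrix v v ℂ) : Matrix v v ℂ :=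
  matIntegral fun t => (logisticDensity t : ℂ) •
    (matPow (visibleState G θ) (-(Complex.I * t / 2)) * X *
      matPow (visibleState G θ) (Complex.I * t / 2))

/-- `Ξ(R) = (1/2) {σ_vh(θ), σ_v(θ)^{-1/2} R σ_v(θ)^{-1/2} ⊗ I_h}`. -/
def mapXi {J : ℕ} (G : Fin J → Matrix (v × h) (v × h) ℂ) (θ : Fin J → ℝ)
    (R : Matrix v v ℂ) : Matrix (v × h) (v × h) ℂ :=
  (1 / 2 : ℂ) • anticomm (thermalState G θ)
    ((matPow (visibleState G θ) (-(1 / 2)) * R * matPow (visibleState G θ) (-(1 / 2))) ⊗ₖ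
      (1 : Matrix h h ℂ))

/-- `Φ(Y) = ∫ γ(t) e^{-iG(θ)t} Y e^{iG(θ)t} dt`. -/
def mapPhi {J : ℕ} (G : Fin J → Matrix n n ℂ) (θ : Fin J → ℝ)
    (Y : Matrix n n ℂ) : Matrix n n ℂ :=
  matIntegral fun t => (tentDensity t : ℂ) •
    (NormedSpace.exp (-(Complex.I * t) • ham G θ) * Y *
      NormedSpace.exp ((Complex.I * t) • ham G θ))

/-- `Σ = Φ ∘ Ξ ∘ Υ`. -/
def mapSigma {J : ℕ} (G : Fin J → Matrix (v × h) (v × h) ℂ) (θ : Fin J → ℝ) :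
    Matrix v v ℂ → Matrix (v × h) (v × h) ℂ :=
  mapPhi G θ ∘ mapXi G θ ∘ mapUpsilon G θ

/-- The map `F ⊗ id_k` for an ancilla of dimension `k`: `F` acts on each of the `k × k` blocks. -/
def ampliation (F : Matrix n n ℂ → Matrix m m ℂ) (k : ℕ)
    (M : Matrix (n × Fin k) (n × Fin k) ℂ) : Matrix (m × Fin k) (m × Fin k) ℂ :=
  Matrix.of fun p q => F (Matrix.of fun a b => M (a, p.2) (b, q.2)) p.1 q.1

/-- Quantum channels: linear, completely positive, trace-preserving maps. -/
structure IsQuantumChannel (F : Matrix n n ℂ → Matrix m m ℂ) : Prop where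
  linear : IsLinearMap ℂ F
  completelyPositive : ∀ (k : ℕ) (M : Matrix (n × Fin k) (n × Fin k) ℂ),
    M.PosSemidef → (ampliation F k M).PosSemidef
  trace_preserving : ∀ X, (F X).trace = X.trace

/-- Hermiticity-preserving, trace-preserving superoperators. -/
structure IsHPTP (F : Matrix n n ℂ → Matrix m m ℂ) : Prop where
  linear : IsLinearMap ℂ F
  hermiticity_preserving : ∀ X, X.IsHermitian → (F X).IsHermitian
  trace_preserving : ∀ X, (F X).trace = X.trace

end QBM

end

open scoped Matrix Kronecker ComplexOrder

noncomputable section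

namespace QBM

open MeasureTheory Set

/-! Everything reduces to scalar identities. Fix a Hermitian `K`. Matrices `X` with `K X = a X` and
`X K = b X` span the matrix space (`induction_of_isHermitian`). On such `X`, averaging `e^{-itK} X
e^{itK}` against a density `f` multiplies by the Fourier transform of `f` at `a - b`, and the
derivative of `exp` at `K` multiplies by the divided difference `(e^a - e^b)/(a - b)`.

The transform of `γ` is `tanh(w/2)/(w/2)`, which makes the derivative of `exp` at `-K` equal to `X ↦
½{e^{-K}, Φ(X)}` (`fderiv_exp_neg`). The transform of `β` is `w/sinh w`, which makes `X ↦ σ^{-1/2}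
Υ(X) σ^{-1/2}` a left inverse of the derivative of `exp` at `ln σ` (`logDerivMap_fderiv_exp`), hence
the derivative of `ln` at `σ`.

So `∂_j σ_vh = ⟨G_j⟩ σ_vh - ½{σ_vh, Φ(G_j)}`. Take the partial trace, apply the derivative of `ln`
and pair with `ρ`. As `γ` and `β` are even, all these maps are symmetric for `Tr[XY]`, so they move
from `G_j` onto `ρ` and compose to `Σ(ρ)`. The term `⟨G_j⟩ σ_vh` contributes `⟨G_j⟩ Tr ρ`, since the
derivative of `ln` at `σ_v` sends `σ_v` to `1`. `Φ` and `Υ` are channels because they are mixtures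
of unitary conjugations. -/

/-! ### The logistic density and its Fourier transform -/

lemma logisticDensity_eq_sigmoid (t : ℝ) :
    logisticDensity t =
      Real.pi * (Real.sigmoid (Real.pi * t) * (1 - Real.sigmoid (Real.pi * t))) := by
  rw [← Real.sigmoid_neg, logisticDensity, Real.cosh_eq, Real.sigmoid_def, Real.sigmoid_def,
    neg_neg]
  have h1 : Real.exp (Real.pi * t) * Real.exp (-(Real.pi * t)) = 1 := by
    rw [← Real.exp_add]; simp
  have := Real.exp_pos (Real.pi * t)
  have := Real.exp_pos (-(Real.pi * t))
  rw [← mul_inv, ← div_eq_mul_inv]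
  congr 1
  linear_combination -h1

lemma logisticDensity_nonneg (t : ℝ) : 0 ≤ logisticDensity t := by
  have := Real.cosh_pos (Real.pi * t)
  unfold logisticDensity
  positivity

/-- The substitution `x = sigmoid (π t)`, a bijection onto `(0, 1)` with Jacobian `β`, yields the
integrability, the mass and the Fourier transform of `β`. -/
lemma hasDerivAt_sigmoid_pi_mul (t : ℝ) :
    HasDerivAt (fun t => Real.sigmoid (Real.pi * t)) (logisticDensity t) t := by
  have := (Real.hasDerivAt_sigmoid (Real.pi * t)).comp t ((hasDerivAt_id t).const_mul Real.pi)
  rw [logisticDensity_eq_sigmoid]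
  refine this.congr_deriv ?_
  ring

lemma image_sigmoid_pi_mul : (fun t => Real.sigmoid (Real.pi * t)) '' univ = Ioo 0 1 := by
  rw [image_univ, ← Real.range_sigmoid]
  exact (mul_left_surjective₀ Real.pi_ne_zero).range_comp Real.sigmoid

lemma injOn_sigmoid_pi_mul : InjOn (fun t => Real.sigmoid (Real.pi * t)) univ :=
  fun _ _ _ _ hxy => mul_left_cancel₀ Real.pi_ne_zero (Real.sigmoid_injective hxy)

lemma integrable_logisticDensity : Integrable logisticDensity := by
  have := (integrableOn_image_iff_integrableOn_abs_deriv_smul (s := univ)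
    (f := fun t => Real.sigmoid (Real.pi * t)) (f' := logisticDensity) MeasurableSet.univ
    (fun t _ => (hasDerivAt_sigmoid_pi_mul t).hasDerivWithinAt) injOn_sigmoid_pi_mul
    (fun _ => (1 : ℝ))).1 (by rw [image_sigmoid_pi_mul]; simp)
  simpa [abs_of_nonneg (logisticDensity_nonneg _)] using this

lemma integral_logisticDensity_smul (g : ℝ → ℂ) :
    ∫ t, (logisticDensity t : ℂ) * g (Real.sigmoid (Real.pi * t)) = ∫ x in Ioo 0 1, g x := by
  have := integral_image_eq_integral_abs_deriv_smul (s := univ)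
    (f := fun t => Real.sigmoid (Real.pi * t)) (f' := logisticDensity) MeasurableSet.univ
    (fun t _ => (hasDerivAt_sigmoid_pi_mul t).hasDerivWithinAt) injOn_sigmoid_pi_mul g
  rw [image_sigmoid_pi_mul] at this
  rw [this]
  simp [abs_of_nonneg (logisticDensity_nonneg _)]

lemma integral_logisticDensity : ∫ t, logisticDensity t = 1 := by
  have := integral_logisticDensity_smul fun _ => 1
  simp only [mul_one] at this
  rw [integral_complex_ofReal] at this
  have h : ((∫ t, logisticDensity t : ℝ) : ℂ) = (1 : ℝ) := by rw [this]; simp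
  exact_mod_cast h

lemma isProbDensity_logisticDensity : IsProbDensity logisticDensity :=
  ⟨logisticDensity_nonneg, integrable_logisticDensity, integral_logisticDensity⟩

/-- The Fourier transform of the logistic density. -/
lemma fourier_logisticDensity {w : ℝ} (hw : w ≠ 0) :
    ∫ t : ℝ, (logisticDensity t : ℂ) * Complex.exp (-(Complex.I * w * t)) =
      w / Real.sinh w := by
  have hpi : (Real.pi : ℂ) ≠ 0 := by exact_mod_cast Real.pi_ne_zero
  have hwc : (w : ℂ) ≠ 0 := by exact_mod_cast hw
  -- With `x = sigmoid (π t)`, `e^{πt} = x/(1-x)`, so `e^{-iwt} = x^{-s} (1-x)^s`: the transform is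
  -- `B(1-s, 1+s) = s Γ(s) Γ(1-s)`, and the reflection formula applies with `π s = i w`.
  set s : ℂ := Complex.I * w / Real.pi with hs
  have hsre : s.re = 0 := by
    rw [hs, Complex.div_ofReal_re]; simp
  have hbeta : Complex.betaIntegral (1 - s) (1 + s) =
      ∫ t : ℝ, (logisticDensity t : ℂ) * Complex.exp (-(Complex.I * w * t)) := by
    rw [Complex.betaIntegral, intervalIntegral.integral_of_le zero_le_one,
      integral_Ioc_eq_integral_Ioo, ← integral_logisticDensity_smul]
    refine integral_congr_ae (.of_forall fun t => ?_)
    have h0 := Real.sigmoid_pos (Real.pi * t)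
    have h1 := Real.sigmoid_pos (-(Real.pi * t))
    have hlog : Real.log (Real.sigmoid (-(Real.pi * t))) =
        Real.log (Real.sigmoid (Real.pi * t)) - Real.pi * t := by
      rw [← Real.sigmoid_mul_rexp_neg, Real.log_mul h0.ne' (Real.exp_pos _).ne', Real.log_exp]
      ring
    simp only
    congr 1
    rw [← Complex.ofReal_one, ← Complex.ofReal_sub, ← Real.sigmoid_neg,
      Complex.cpow_def_of_ne_zero (by exact_mod_cast h0.ne'),
      Complex.cpow_def_of_ne_zero (by exact_mod_cast h1.ne'), ← Complex.ofReal_log h0.le,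
      ← Complex.ofReal_log h1.le, hlog, ← Complex.exp_add]
    congr 1
    rw [hs]
    push_cast
    field_simp
    ring
  have hGamma := Complex.Gamma_mul_Gamma_eq_betaIntegral (s := 1 - s) (t := 1 + s)
    (by simp [hsre]) (by simp [hsre])
  have hs0 : s ≠ 0 := by
    rw [hs]
    exact div_ne_zero (mul_ne_zero Complex.I_ne_zero hwc) hpi
  have hsum : (1 - s) + (1 + s) = ((1 : ℕ) : ℂ) + 1 := by push_cast; ring
  rw [← hbeta]
  rw [hsum, Complex.Gamma_nat_eq_factorial, add_comm 1 s, Complex.Gamma_add_one s hs0] at hGamma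
  have hrefl := Complex.Gamma_mul_Gamma_one_sub s
  have harg : (Real.pi : ℂ) * s = w * Complex.I := by rw [hs]; field_simp
  rw [harg, Complex.sin_mul_I] at hrefl
  have hsinh : Complex.sinh w ≠ 0 := by
    rw [← Complex.ofReal_sinh]
    exact_mod_cast fun h => hw (Real.sinh_eq_zero.1 h)
  rw [add_comm s 1] at hGamma
  simp only [Nat.factorial_one, Nat.cast_one, one_mul] at hGamma
  rw [← hGamma]
  push_cast
  calc _ = s * (Complex.Gamma s * Complex.Gamma (1 - s)) := by ring
    _ = _ := by
      rw [hrefl, hs]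
      field_simp

/-! ### The tent density and its Fourier transform -/

lemma tentDensity_eq_log {t : ℝ} (ht : t ≠ 0) :
    tentDensity t = 2 / Real.pi * (Real.log (1 + Real.exp (-(Real.pi * |t|))) -
      Real.log (1 - Real.exp (-(Real.pi * |t|)))) := by
  have hpi := Real.pi_pos
  have key : ∀ s : ℝ, 0 < s → |Real.cosh (Real.pi * s / 2) / Real.sinh (Real.pi * s / 2)| =
      (1 + Real.exp (-(Real.pi * s))) / (1 - Real.exp (-(Real.pi * s))) := by
    intro s hs
    have h1 : Real.exp (-(Real.pi * s)) < 1 := Real.exp_lt_one_iff.2 (by nlinarith)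
    have h2 : 0 < Real.sinh (Real.pi * s / 2) := Real.sinh_pos_iff.2 (by positivity)
    have h3 := Real.cosh_pos (Real.pi * s / 2)
    rw [abs_of_pos (div_pos h3 h2), div_eq_div_iff h2.ne' (by linarith), Real.cosh_eq,
      Real.sinh_eq]
    have h4 : Real.exp (-(Real.pi * s)) =
        Real.exp (-(Real.pi * s / 2)) * Real.exp (-(Real.pi * s / 2)) := by
      rw [← Real.exp_add]; ring_nf
    have h5 : Real.exp (Real.pi * s / 2) * Real.exp (-(Real.pi * s / 2)) = 1 := by
      rw [← Real.exp_add]; simp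
    rw [h4]
    linear_combination (-2 * Real.exp (-(Real.pi * s / 2)) / 2) * h5
  have h1 : Real.exp (-(Real.pi * |t|)) < 1 :=
    Real.exp_lt_one_iff.2 (by have := abs_pos.2 ht; nlinarith)
  have habs : |Real.cosh (Real.pi * t / 2) / Real.sinh (Real.pi * t / 2)| =
      |Real.cosh (Real.pi * |t| / 2) / Real.sinh (Real.pi * |t| / 2)| := by
    rcases abs_choice t with h | h <;> rw [h]
    rw [show Real.pi * -t / 2 = -(Real.pi * t / 2) by ring, Real.cosh_neg, Real.sinh_neg, div_neg,
      abs_neg]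
  rw [tentDensity, habs, key _ (abs_pos.2 ht), Real.log_div (by positivity) (by linarith)]

/-- This is the odd power series of `ln((1+q)/(1-q))` at `q = e^{-π|t|}`; it gives positivity and
allows termwise Fourier transformation. -/
lemma hasSum_tentDensity {t : ℝ} (ht : t ≠ 0) :
    HasSum (fun k : ℕ => 4 / (Real.pi * (2 * k + 1)) * Real.exp (-((2 * k + 1) * Real.pi) * |t|))
      (tentDensity t) := by
  have hpi := Real.pi_pos
  have h1 : |Real.exp (-(Real.pi * |t|))| < 1 := by
    rw [abs_of_pos (Real.exp_pos _)]
    exact Real.exp_lt_one_iff.2 (by have := abs_pos.2 ht; nlinarith)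
  rw [tentDensity_eq_log ht]
  convert! (Real.hasSum_log_sub_log_of_abs_lt_one h1).mul_left (2 / Real.pi) using 2 with k
  rw [← Real.exp_nat_mul, show ((2 * k + 1 : ℕ) : ℝ) * -(Real.pi * |t|) =
    -((2 * k + 1) * Real.pi) * |t| by push_cast; ring]
  field_simp
  ring

lemma tentDensity_nonneg (t : ℝ) : 0 ≤ tentDensity t := by
  rcases eq_or_ne t 0 with rfl | ht
  -- At `t = 0` the conventions `1/0 = 0` and `log 0 = 0` give the value `0`.
  · simp [tentDensity]
  · exact (hasSum_tentDensity ht).nonneg fun k => by have := Real.pi_pos; positivity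

lemma integrable_exp_neg_mul_abs_mul {c : ℝ} (hc : 0 < c) (w : ℝ) :
    Integrable (fun t : ℝ => (Real.exp (-c * |t|) : ℂ) * Complex.exp (-(Complex.I * w * t))) ∧
    ∫ t : ℝ, (Real.exp (-c * |t|) : ℂ) * Complex.exp (-(Complex.I * w * t)) =
      2 * c / (c ^ 2 + w ^ 2) := by
  set f : ℝ → ℂ := fun t => (Real.exp (-c * |t|) : ℂ) * Complex.exp (-(Complex.I * w * t)) with hf
  have hp : ∀ t ∈ Ioi (0 : ℝ), f t = Complex.exp ((-c - Complex.I * w) * t) := by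
    intro t ht
    simp only [hf]
    rw [abs_of_pos ht, Complex.ofReal_exp, ← Complex.exp_add]
    congr 1; push_cast; ring
  have hn : ∀ t ∈ Iic (0 : ℝ), f t = Complex.exp ((c - Complex.I * w) * t) := by
    intro t ht
    simp only [hf]
    rw [abs_of_nonpos ht, Complex.ofReal_exp, ← Complex.exp_add]
    congr 1; push_cast; ring
  have hrep : (-c - Complex.I * w).re < 0 := by simpa using hc
  have hren : 0 < (c - Complex.I * w).re := by simpa using hc
  have hip : IntegrableOn f (Ioi 0) :=
    (integrableOn_exp_mul_complex_Ioi hrep 0).congr_fun (fun t ht => (hp t ht).symm)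
      measurableSet_Ioi
  have hin : IntegrableOn f (Iic 0) :=
    (integrableOn_exp_mul_complex_Iic hren 0).congr_fun (fun t ht => (hn t ht).symm)
      measurableSet_Iic
  refine ⟨?_, ?_⟩
  · have := hin.union hip
    rwa [Iic_union_Ioi, integrableOn_univ] at this
  · rw [← intervalIntegral.integral_Iic_add_Ioi hin hip, setIntegral_congr_fun measurableSet_Ioi hp,
      setIntegral_congr_fun measurableSet_Iic hn, integral_exp_mul_complex_Ioi hrep,
      integral_exp_mul_complex_Iic hren]
    have h1 : (-c - Complex.I * w) ≠ 0 := fun h => by rw [h] at hrep; simp at hrep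
    have h2 : (c - Complex.I * w) ≠ 0 := fun h => by rw [h] at hren; simp at hren
    have h3 : (c ^ 2 + w ^ 2 : ℂ) ≠ 0 := by
      have : 0 < c ^ 2 + w ^ 2 := by positivity
      exact_mod_cast this.ne'
    simp only [Complex.ofReal_zero, mul_zero, Complex.exp_zero]
    field_simp
    ring_nf
    simp only [Complex.I_sq]
    ring

/-- The Mittag-Leffler expansion of the hyperbolic cotangent. -/
lemma hasSum_one_div_sq_add_sq {w : ℝ} (hw : w ≠ 0) :
    HasSum (fun n : ℕ => 1 / ((w : ℂ) ^ 2 + (n * Real.pi) ^ 2))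
      ((Complex.cosh w / (Complex.sinh w * w) + 1 / w ^ 2) / 2) := by
  have hpi : (Real.pi : ℂ) ≠ 0 := by exact_mod_cast Real.pi_ne_zero
  have hwc : (w : ℂ) ≠ 0 := by exact_mod_cast hw
  have hsinh : Complex.sinh w ≠ 0 := by
    rw [← Complex.ofReal_sinh]
    exact_mod_cast fun h => hw (Real.sinh_eq_zero.1 h)
  -- At this imaginary point, which is not an integer, the cotangent series becomes the one for
  -- `coth w`.
  set x : ℂ := w * Complex.I / Real.pi with hx
  have him : x.im = w / Real.pi := by
    rw [hx, Complex.div_ofReal_im]; simp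
  have hxm : x ∈ Complex.integerComplement := by
    rintro ⟨k, hk⟩
    have := congrArg Complex.im hk
    rw [him] at this
    simp only [Complex.intCast_im] at this
    exact div_ne_zero hw Real.pi_ne_zero this.symm
  have h := (summable_cotTerm hxm).hasSum
  have h2 := cot_series_rep' hxm
  have h3 : ∑' n : ℕ, cotTerm x n = Real.pi * Complex.cot (Real.pi * x) - 1 / x := h2.symm
  rw [h3] at h
  have harg : (Real.pi : ℂ) * x = w * Complex.I := by rw [hx]; field_simp
  rw [harg, Complex.cot, Complex.cos_mul_I, Complex.sin_mul_I] at h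
  have hterm : ∀ n : ℕ, cotTerm x n =
      (-2 * w * Complex.I * Real.pi) * (1 / ((w : ℂ) ^ 2 + ((n + 1 : ℕ) * Real.pi) ^ 2)) := by
    intro n
    rw [cotTerm_identity hxm]
    have hne : (w : ℂ) ^ 2 + ((n + 1 : ℕ) * Real.pi) ^ 2 ≠ 0 := by
      have : 0 < w ^ 2 + ((n + 1 : ℕ) * Real.pi) ^ 2 := by positivity
      exact_mod_cast this.ne'
    have hprod : (x + (n + 1)) * (x - (n + 1)) =
        -((w : ℂ) ^ 2 + ((n + 1 : ℕ) * Real.pi) ^ 2) / Real.pi ^ 2 := by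
      rw [hx]
      push_cast
      field_simp
      ring_nf
      simp only [Complex.I_sq]
      ring
    rw [hprod, hx]
    field_simp
  simp_rw [hterm] at h
  have hc : (-2 * w * Complex.I * Real.pi : ℂ) ≠ 0 := by
    simp [hwc, hpi]
  have h' := h.mul_left (-2 * w * Complex.I * Real.pi : ℂ)⁻¹
  simp_rw [inv_mul_cancel_left₀ hc] at h'
  -- The cotangent series runs over `n ≥ 1`; the term `n = 0` is `1/w²`.
  rw [← hasSum_nat_add_iff' 1]
  convert! h' using 1
  rw [hx]
  simp only [Finset.sum_range_one, Nat.cast_zero, zero_mul]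
  field_simp
  ring_nf
  simp only [Complex.I_sq]
  ring

lemma hasSum_odd_of_hasSum_even {f : ℕ → ℂ} {a b : ℂ} (h : HasSum f a)
    (he : HasSum (fun k => f (2 * k)) b) : HasSum (fun k => f (2 * k + 1)) (a - b) := by
  have ho : Summable fun k => f (2 * k + 1) :=
    h.summable.comp_injective fun i j hij => by simpa using hij
  have := (he.even_add_odd ho.hasSum).unique h
  rw [← this, add_sub_cancel_left]
  exact ho.hasSum

/-- The Mittag-Leffler expansion of the hyperbolic tangent. -/
lemma hasSum_tanh {w : ℝ} (hw : w ≠ 0) :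
    HasSum (fun k : ℕ => 8 / (((2 * k + 1 : ℂ) * Real.pi) ^ 2 + w ^ 2))
      (2 * Complex.sinh (w / 2) / (w * Complex.cosh (w / 2))) := by
  have hwc : (w : ℂ) ≠ 0 := by exact_mod_cast hw
  -- The even terms are a quarter of the same series at `w/2`; subtracting them leaves the odd ones.
  have he : HasSum (fun k : ℕ => 1 / ((w : ℂ) ^ 2 + (((2 * k : ℕ) : ℂ) * Real.pi) ^ 2)) _ :=
    ((hasSum_one_div_sq_add_sq (div_ne_zero hw two_ne_zero)).mul_left (1 / 4)).congr_fun
      fun k => by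
        push_cast
        rw [one_div_mul_one_div]
        congr 1
        ring
  have ho := (hasSum_odd_of_hasSum_even (hasSum_one_div_sq_add_sq hw) he).mul_left 8
  have hsinh : Complex.sinh (w / 2 : ℂ) ≠ 0 := by
    have : Real.sinh (w / 2) ≠ 0 := fun h => hw (by simpa using Real.sinh_eq_zero.1 h)
    have h2 : ((Real.sinh (w / 2) : ℝ) : ℂ) ≠ 0 := by exact_mod_cast this
    simpa using h2
  have hcosh : Complex.cosh (w / 2 : ℂ) ≠ 0 := by
    have h2 : ((Real.cosh (w / 2) : ℝ) : ℂ) ≠ 0 := by exact_mod_cast (Real.cosh_pos _).ne'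
    simpa using h2
  convert! ho using 1
  · ext k
    push_cast
    rw [add_comm, mul_one_div]
  · have h1 : Complex.sinh w = 2 * Complex.sinh (w / 2) * Complex.cosh (w / 2) := by
      rw [← Complex.sinh_two_mul]; congr 1; ring
    have h2 : Complex.cosh w = Complex.cosh (w / 2) ^ 2 + Complex.sinh (w / 2) ^ 2 := by
      rw [← Complex.cosh_two_mul]; congr 1; ring
    rw [h1, h2]
    push_cast
    field_simp
    ring

/-- The case `w = 0`, excluded above, comes from `ζ(2)` by the same removal of even terms. It gives
the mass of `γ` and the summability behind termwise integration. -/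
lemma hasSum_tanh_zero :
    HasSum (fun k : ℕ => 8 / (((2 * k + 1 : ℂ) * Real.pi) ^ 2)) 1 := by
  have hpi : (Real.pi : ℂ) ≠ 0 := by exact_mod_cast Real.pi_ne_zero
  have h : HasSum (fun n : ℕ => (1 : ℂ) / (n : ℂ) ^ 2) (Real.pi ^ 2 / 6) := by
    simpa using Complex.hasSum_ofReal.2 hasSum_zeta_two
  have he : HasSum (fun k : ℕ => (1 : ℂ) / ((2 * k : ℕ) : ℂ) ^ 2) _ :=
    (h.mul_left (1 / 4)).congr_fun fun k => by
        push_cast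
        rw [one_div_mul_one_div]
        congr 1
        ring
  have ho := (hasSum_odd_of_hasSum_even h he).mul_left (8 / Real.pi ^ 2 : ℂ)
  convert! ho using 1
  · ext k
    push_cast
    rw [div_mul_div_comm, mul_one]
    congr 1
    ring
  · field_simp
    ring

/-- Termwise integration of the exponential series: the `L¹` norms of its terms are their transforms
at `w = 0`, which are summable. -/
lemma hasSum_fourier_tentDensity (w : ℝ) :
    HasSum (fun k : ℕ => 8 / (((2 * k + 1 : ℂ) * Real.pi) ^ 2 + w ^ 2))
      (∫ t : ℝ, (tentDensity t : ℂ) * Complex.exp (-(Complex.I * w * t))) := by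
  have hpi := Real.pi_pos
  have hpic : (Real.pi : ℂ) ≠ 0 := by exact_mod_cast Real.pi_ne_zero
  set c : ℕ → ℝ := fun k => (2 * k + 1) * Real.pi with hc
  have hcpos : ∀ k, 0 < c k := fun k => by simp only [hc]; positivity
  set F : ℕ → ℝ → ℂ := fun k t => ((4 / (Real.pi * (2 * k + 1)) : ℝ) : ℂ) *
    ((Real.exp (-c k * |t|) : ℂ) * Complex.exp (-(Complex.I * w * t))) with hF
  have hint : ∀ k, Integrable (F k) := fun k =>
    (integrable_exp_neg_mul_abs_mul (hcpos k) w).1.const_mul _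
  have hk : ∀ k : ℕ, (2 * k + 1 : ℂ) ≠ 0 := fun k => by exact_mod_cast Nat.succ_ne_zero (2 * k)
  have hval : ∀ (k : ℕ) (v : ℝ), ((4 / (Real.pi * (2 * k + 1)) : ℝ) : ℂ) *
      (2 * c k / ((c k : ℂ) ^ 2 + v ^ 2)) = 8 / (((2 * k + 1 : ℂ) * Real.pi) ^ 2 + v ^ 2) := by
    intro k v
    have h0 : ((2 * k + 1 : ℂ) * Real.pi) ^ 2 + v ^ 2 ≠ 0 := by
      have : 0 < ((2 * k + 1 : ℝ) * Real.pi) ^ 2 + v ^ 2 := by positivity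
      exact_mod_cast this.ne'
    have := hk k
    simp only [hc]
    push_cast
    field_simp
    ring
  have hnorm : ∀ k, ∫ t, ‖F k t‖ = (8 / ((2 * k + 1) * Real.pi) ^ 2 : ℝ) := by
    intro k
    have h1 : ∀ t, ((‖F k t‖ : ℝ) : ℂ) = ((4 / (Real.pi * (2 * k + 1)) : ℝ) : ℂ) *
        ((Real.exp (-c k * |t|) : ℂ) * Complex.exp (-(Complex.I * (0 : ℝ) * t))) := by
      intro t
      have h2 : ‖Complex.exp (-(Complex.I * w * t))‖ = 1 := by
        rw [Complex.norm_exp]; simp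
      simp only [hF]
      rw [norm_mul, norm_mul, h2, Complex.norm_real, Complex.norm_real,
        Real.norm_of_nonneg (by positivity), Real.norm_of_nonneg (Real.exp_pos _).le]
      simp
    have h3 : ((∫ t, ‖F k t‖ : ℝ) : ℂ) = ((8 / ((2 * k + 1) * Real.pi) ^ 2 : ℝ) : ℂ) := by
      rw [← integral_complex_ofReal]
      simp_rw [h1]
      rw [integral_const_mul, (integrable_exp_neg_mul_abs_mul (hcpos k) 0).2, hval]
      push_cast
      ring
    exact_mod_cast h3
  have hsum : Summable fun k => ∫ t, ‖F k t‖ := by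
    simp_rw [hnorm]
    have := hasSum_tanh_zero.summable
    exact_mod_cast this
  have key := hasSum_integral_of_summable_integral_norm hint hsum
  have hae : ∀ᵐ t : ℝ, ∑' k, F k t =
      (tentDensity t : ℂ) * Complex.exp (-(Complex.I * w * t)) := by
    have h0 : ∀ᵐ t : ℝ, t ≠ 0 := by simp [ae_iff]
    filter_upwards [h0] with t ht
    have h1 : HasSum (fun k => ((4 / (Real.pi * (2 * k + 1)) * Real.exp (-c k * |t|) : ℝ) : ℂ))
        (tentDensity t : ℂ) := Complex.hasSum_ofReal.2 (hasSum_tentDensity ht)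
    refine (HasSum.congr_fun (h1.mul_right _) fun k => ?_).tsum_eq
    simp only [hF]
    push_cast
    ring
  rw [integral_congr_ae hae] at key
  refine key.congr_fun fun k => ?_
  simp only [hF]
  rw [integral_const_mul, (integrable_exp_neg_mul_abs_mul (hcpos k) w).2, hval]

lemma integral_tentDensity : ∫ t, tentDensity t = 1 := by
  have h := hasSum_fourier_tentDensity 0
  have h2 := hasSum_tanh_zero
  simp only [Complex.ofReal_zero, ne_eq, OfNat.ofNat_ne_zero, not_false_eq_true, zero_pow, add_zero,
    mul_zero, zero_mul, neg_zero, Complex.exp_zero, mul_one] at h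
  have h3 := h.unique h2
  rw [integral_complex_ofReal] at h3
  exact_mod_cast h3

lemma isProbDensity_tentDensity : IsProbDensity tentDensity :=
  ⟨tentDensity_nonneg,
    -- A non-integrable function has integral `0` by convention, so mass `1` forces integrability.
    .of_integral_ne_zero (by rw [integral_tentDensity]; exact one_ne_zero), integral_tentDensity⟩

/-- The Fourier transform of the high-peak tent density. -/
lemma fourier_tentDensity {w : ℝ} (hw : w ≠ 0) :
    ∫ t : ℝ, (tentDensity t : ℂ) * Complex.exp (-(Complex.I * w * t)) =
      2 * Complex.sinh (w / 2) / (w * Complex.cosh (w / 2)) :=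
  (hasSum_fourier_tentDensity w).unique (hasSum_tanh hw)

lemma tentDensity_neg (t : ℝ) : tentDensity (-t) = tentDensity t := by
  simp only [tentDensity]
  rw [show Real.pi * -t / 2 = -(Real.pi * t / 2) by ring, Real.cosh_neg, Real.sinh_neg, div_neg,
      abs_neg]

lemma logisticDensity_neg (t : ℝ) : logisticDensity (-t) = logisticDensity t := by
  simp [logisticDensity]

/-! ### Matrix integrals, joint eigenvectors and unitary averages -/

section
variable {n : Type*} [Fintype n]

lemma smul_mul_of_eigen {A X : Matrix n n ℂ} {a : ℂ} (z : ℂ) (h : A * X = a • X) :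
    (z • A) * X = (z * a) • X := by
  rw [Matrix.smul_mul, h, smul_smul]

lemma mul_smul_of_eigen {A X : Matrix n n ℂ} {a : ℂ} (z : ℂ) (h : X * A = a • X) :
    X * (z • A) = (z * a) • X := by
  rw [Matrix.mul_smul, h, smul_smul]

/-- The ampliation is conjugation by `U ⊗ 1`. -/
lemma posSemidef_ampliation_conj (U : Matrix n n ℂ) (k : ℕ)
    {M : Matrix (n × Fin k) (n × Fin k) ℂ} (hM : M.PosSemidef) :
    (ampliation (fun X => U * X * Uᴴ) k M).PosSemidef := by
  convert hM.mul_mul_conjTranspose_same (U ⊗ₖ (1 : Matrix (Fin k) (Fin k) ℂ)) using 1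
  ext ⟨i, p⟩ ⟨j, q⟩
  simp only [ampliation, Matrix.of_apply, Matrix.mul_apply, Fintype.sum_prod_type,
    Matrix.kroneckerMap_apply, Matrix.conjTranspose_apply, Matrix.one_apply, mul_ite, mul_one,
    mul_zero, ite_mul, zero_mul, apply_ite star, star_zero, Finset.sum_ite_eq, Finset.mem_univ,
    if_true]

lemma trace_mul_matIntegral (X : Matrix n n ℂ) {F : ℝ → Matrix n n ℂ}
    (hF : ∀ i j, Integrable fun t => F t i j) :
    (X * matIntegral F).trace = ∫ t, (X * F t).trace := by
  simp only [Matrix.trace, Matrix.diag, Matrix.mul_apply]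
  refine Eq.symm ((integral_finsetSum _ fun i _ => integrable_finsetSum _ fun j _ =>
    (hF j i).const_mul _).trans (Finset.sum_congr rfl fun i _ => ?_))
  refine (integral_finsetSum _ fun j _ => (hF j i).const_mul _).trans
    (Finset.sum_congr rfl fun j _ => ?_)
  rw [integral_const_mul]
  rfl

lemma posSemidef_matIntegral {F : ℝ → Matrix n n ℂ} (hF : ∀ i j, Integrable fun t => F t i j)
    (hpos : ∀ t, (F t).PosSemidef) : (matIntegral F).PosSemidef := by
  refine .of_dotProduct_mulVec_nonneg ?_ fun x => ?_
  · ext i j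
    simp only [Matrix.conjTranspose_apply, matIntegral, Matrix.of_apply]
    rw [← starRingEnd_apply, ← integral_conj]
    congr 1
    ext t
    exact (hpos t).isHermitian.apply i j
  -- The quadratic form at `x` is the trace against `x x*`, which commutes with the integral.
  · have h := trace_mul_matIntegral (Matrix.vecMulVec x (star x)) hF
    have hv : ∀ M : Matrix n n ℂ, (Matrix.vecMulVec x (star x) * M).trace =
        star x ⬝ᵥ (M *ᵥ x) := by
      intro M
      rw [Matrix.vecMulVec_mul, Matrix.trace_vecMulVec, dotProduct_comm,
        Matrix.dotProduct_mulVec]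
    simp only [hv] at h
    rw [h]
    exact integral_nonneg fun t => (hpos t).dotProduct_mulVec_nonneg x

variable [DecidableEq n]

lemma diagonal_mul_single_eq_smul (d : n → ℂ) (i j : n) (c : ℂ) :
    Matrix.diagonal d * Matrix.single i j c = d i • Matrix.single i j c := by
  ext k l
  simp only [Matrix.diagonal_mul, Matrix.single_apply, Matrix.smul_apply, smul_eq_mul]
  split_ifs with h
  · rw [h.1]
  · simp

lemma single_mul_diagonal_eq_smul (d : n → ℂ) (i j : n) (c : ℂ) :
    Matrix.single i j c * Matrix.diagonal d = d j • Matrix.single i j c := by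
  ext k l
  simp only [Matrix.mul_diagonal, Matrix.single_apply, Matrix.smul_apply, smul_eq_mul]
  split_ifs with h
  · rw [h.2, mul_comm]
  · simp

/-- Every matrix is a sum of simultaneous left and right eigenvectors of a Hermitian matrix. -/
lemma induction_of_isHermitian {A : Matrix n n ℂ} (hA : A.IsHermitian)
    {P : Matrix n n ℂ → Prop} (zero : P 0) (add : ∀ X Y, P X → P Y → P (X + Y))
    (eigen : ∀ (X : Matrix n n ℂ) (a b : ℝ), A * X = (a : ℂ) • X → X * A = (b : ℂ) • X → P X)
    (X : Matrix n n ℂ) : P X := by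
  set U : Matrix n n ℂ := (hA.eigenvectorUnitary).1 with hU
  have hUU : U * star U = 1 := Unitary.coe_mul_star_self _
  have hUU' : star U * U = 1 := Unitary.coe_star_mul_self _
  set D : Matrix n n ℂ := Matrix.diagonal fun i => (hA.eigenvalues i : ℂ) with hD
  have hAU : A = U * D * star U := by
    conv_lhs => rw [hA.spectral_theorem]
    rfl
  -- Matrix units in the eigenbasis are eigenvectors on both sides, with eigenvalues `λ i` and `λ
  -- j`.
  have hX : X = ∑ i, ∑ j, U * Matrix.single i j ((star U * X * U) i j) * star U := by
    simp_rw [← Finset.sum_mul, ← Finset.mul_sum]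
    rw [← Matrix.matrix_eq_sum_single, ← mul_assoc, ← mul_assoc, hUU, one_mul, mul_assoc, hUU,
      mul_one]
  rw [hX]
  have hsum : ∀ (s : Finset n) (f : n → Matrix n n ℂ), (∀ i, P (f i)) → P (∑ i ∈ s, f i) := by
    intro s f hf
    exact Finset.sum_induction f P add zero fun i _ => hf i
  refine hsum _ _ fun i => hsum _ _ fun j =>
    eigen _ (hA.eigenvalues i) (hA.eigenvalues j) ?_ ?_
  · calc A * (U * Matrix.single i j ((star U * X * U) i j) * star U)
        = U * D * (star U * U) * Matrix.single i j ((star U * X * U) i j) * star U := by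
          rw [hAU]; simp only [mul_assoc]
      _ = U * (D * Matrix.single i j ((star U * X * U) i j)) * star U := by
          rw [hUU', mul_one]; simp only [mul_assoc]
      _ = _ := by
          rw [hD, diagonal_mul_single_eq_smul,
            Matrix.mul_smul, Matrix.smul_mul]
  · calc (U * Matrix.single i j ((star U * X * U) i j) * star U) * A
        = U * Matrix.single i j ((star U * X * U) i j) * (star U * U) * D * star U := by
          rw [hAU]; simp only [mul_assoc]
      _ = U * (Matrix.single i j ((star U * X * U) i j) * D) * star U := by
          rw [hUU', mul_one]; simp only [mul_assoc]
      _ = _ := by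
          rw [hD, single_mul_diagonal_eq_smul,
            Matrix.mul_smul, Matrix.smul_mul]

open scoped Matrix.Norms.L2Operator in
lemma exp_mul_of_eigen {A X : Matrix n n ℂ} {a : ℂ} (h : A * X = a • X) :
    NormedSpace.exp A * X = Complex.exp a • X := by
  have hpow : ∀ k : ℕ, A ^ k * X = a ^ k • X := by
    intro k
    induction k with
    | zero => simp
    | succ k ih => rw [pow_succ, mul_assoc, h, Matrix.mul_smul, ih, smul_smul, pow_succ, mul_comm]
  have h1 := (NormedSpace.exp_series_hasSum_exp' (𝕂 := ℂ) A).mul_right X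
  have h2 := (NormedSpace.exp_series_hasSum_exp' (𝕂 := ℂ) a).smul_const X
  rw [← Complex.exp_eq_exp_ℂ] at h2
  refine h1.unique (h2.congr_fun fun k => ?_)
  rw [Matrix.smul_mul, hpow, smul_smul, smul_eq_mul]

lemma mul_exp_of_eigen {A X : Matrix n n ℂ} {a : ℂ} (h : X * A = a • X) :
    X * NormedSpace.exp A = Complex.exp a • X := by
  have := exp_mul_of_eigen (A := Aᵀ) (X := Xᵀ) (a := a)
    (by rw [← Matrix.transpose_mul, h, Matrix.transpose_smul])
  rw [Matrix.exp_transpose, ← Matrix.transpose_mul, ← Matrix.transpose_smul] at this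
  exact Matrix.transpose_injective this

lemma exp_smul_mul_exp_smul (A : Matrix n n ℂ) (z w : ℂ) :
    NormedSpace.exp (z • A) * NormedSpace.exp (w • A) = NormedSpace.exp ((z + w) • A) := by
  rw [add_smul, Matrix.exp_add_of_commute]
  exact ((Commute.refl A).smul_left z).smul_right w

lemma exp_smul_mul_exp_neg_smul (A : Matrix n n ℂ) (z : ℂ) :
    NormedSpace.exp (z • A) * NormedSpace.exp (-z • A) = 1 := by
  rw [exp_smul_mul_exp_smul]; simp

lemma conjTranspose_exp_smul {A : Matrix n n ℂ} (hA : A.IsHermitian) (z : ℂ) :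
    (NormedSpace.exp (z • A))ᴴ = NormedSpace.exp (star z • A) := by
  rw [← Matrix.exp_conjTranspose, Matrix.conjTranspose_smul, hA.eq]

/-- The average of the unitary conjugations `e^{-itK} X e^{itK}` with weight `f`. -/
def unitaryAverage (f : ℝ → ℝ) (K X : Matrix n n ℂ) : Matrix n n ℂ :=
  matIntegral fun t => (f t : ℂ) •
    (NormedSpace.exp (-(Complex.I * t) • K) * X * NormedSpace.exp ((Complex.I * t) • K))

lemma conj_exp_of_eigen {K X : Matrix n n ℂ} {a b : ℝ} (ha : K * X = (a : ℂ) • X)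
    (hb : X * K = (b : ℂ) • X) (t : ℝ) :
    NormedSpace.exp (-(Complex.I * t) • K) * X * NormedSpace.exp ((Complex.I * t) • K) =
      Complex.exp (-(Complex.I * (a - b : ℝ) * t)) • X := by
  rw [exp_mul_of_eigen (smul_mul_of_eigen _ ha), Matrix.smul_mul,
    mul_exp_of_eigen (mul_smul_of_eigen _ hb), smul_smul, ← Complex.exp_add]
  congr 2
  push_cast
  ring

lemma unitaryAverage_of_eigen (f : ℝ → ℝ) {K X : Matrix n n ℂ} {a b : ℝ}
    (ha : K * X = (a : ℂ) • X) (hb : X * K = (b : ℂ) • X) :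
    unitaryAverage f K X =
      (∫ t : ℝ, (f t : ℂ) * Complex.exp (-(Complex.I * (a - b : ℝ) * t))) • X := by
  ext i j
  simp only [unitaryAverage, matIntegral, conj_exp_of_eigen ha hb, Matrix.of_apply,
    Matrix.smul_apply, smul_eq_mul, ← mul_assoc]
  rw [integral_mul_const]

lemma integrable_mul_exp {f : ℝ → ℝ} (hf : Integrable f) (w : ℝ) :
    Integrable fun t : ℝ => (f t : ℂ) * Complex.exp (-(Complex.I * w * t)) := by
  refine hf.ofReal.mul_bdd (c := 1) (by fun_prop) (.of_forall fun t => ?_)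
  rw [Complex.norm_exp]
  simp

lemma integrable_unitaryAverage {f : ℝ → ℝ} (hf : Integrable f) {K : Matrix n n ℂ}
    (hK : K.IsHermitian) (X : Matrix n n ℂ) (i j : n) :
    Integrable fun t : ℝ => ((f t : ℂ) • (NormedSpace.exp (-(Complex.I * t) • K) * X *
      NormedSpace.exp ((Complex.I * t) • K))) i j := by
  induction X using induction_of_isHermitian hK with
  | zero => simp
  | add X Y hX hY =>
    refine (hX.add hY).congr (.of_forall fun t => ?_)
    simp only [mul_add, add_mul, smul_add, Matrix.add_apply, Pi.add_apply]
  | eigen X a b ha hb =>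
    simp only [conj_exp_of_eigen ha hb, Matrix.smul_apply, smul_eq_mul, ← mul_assoc]
    exact (integrable_mul_exp hf _).mul_const _

lemma unitaryAverage_isLinearMap {f : ℝ → ℝ} (hf : Integrable f) {K : Matrix n n ℂ}
    (hK : K.IsHermitian) : IsLinearMap ℂ (unitaryAverage f K) where
  map_add X Y := by
    ext i j
    have := integral_add (integrable_unitaryAverage hf hK X i j)
      (integrable_unitaryAverage hf hK Y i j)
    simpa only [unitaryAverage, matIntegral, Matrix.of_apply, mul_add, add_mul, smul_add,
      Matrix.add_apply] using this
  map_smul c X := by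
    ext i j
    simp only [unitaryAverage, matIntegral, Matrix.of_apply, Matrix.mul_smul, Matrix.smul_mul,
      Matrix.smul_apply, smul_eq_mul, ← integral_const_mul]
    congr 1
    ext t
    ring

/-- Cyclicity of the trace moves the conjugation to the other factor with `t` reversed; evenness of
`f` absorbs the sign. -/
lemma trace_mul_unitaryAverage {f : ℝ → ℝ} (hf : Integrable f) (hf' : ∀ t, f (-t) = f t)
    {K : Matrix n n ℂ} (hK : K.IsHermitian) (X Y : Matrix n n ℂ) :
    (X * unitaryAverage f K Y).trace = (unitaryAverage f K X * Y).trace := by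
  rw [Matrix.trace_mul_comm _ Y, unitaryAverage, unitaryAverage,
    trace_mul_matIntegral _ (integrable_unitaryAverage hf hK Y),
    trace_mul_matIntegral _ (integrable_unitaryAverage hf hK X),
    ← integral_neg_eq_self]
  congr 1
  ext t
  rw [hf', Matrix.mul_smul, Matrix.mul_smul, Matrix.trace_smul, Matrix.trace_smul]
  congr 1
  push_cast
  rw [mul_neg, neg_neg, ← mul_assoc, Matrix.trace_mul_comm, ← mul_assoc, ← mul_assoc,
    Matrix.trace_mul_comm, ← mul_assoc]

lemma trace_unitaryAverage {f : ℝ → ℝ} (hf : IsProbDensity f) {K : Matrix n n ℂ}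
    (hK : K.IsHermitian) (X : Matrix n n ℂ) : (unitaryAverage f K X).trace = X.trace := by
  have h := trace_mul_matIntegral 1 (integrable_unitaryAverage hf.integrable hK X)
  rw [one_mul] at h
  rw [unitaryAverage, h]
  have : ∀ t : ℝ, (1 * ((f t : ℂ) • (NormedSpace.exp (-(Complex.I * t) • K) * X *
      NormedSpace.exp ((Complex.I * t) • K)))).trace = (f t : ℂ) * X.trace := by
    intro t
    rw [one_mul, Matrix.trace_smul, smul_eq_mul, Matrix.trace_mul_comm, ← mul_assoc,
      exp_smul_mul_exp_neg_smul, one_mul]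
  simp_rw [this]
  rw [integral_mul_const, integral_complex_ofReal, hf.integral_eq_one]
  simp

lemma isQuantumChannel_unitaryAverage {f : ℝ → ℝ} (hf : IsProbDensity f) {K : Matrix n n ℂ}
    (hK : K.IsHermitian) : IsQuantumChannel (unitaryAverage f K) where
  linear := unitaryAverage_isLinearMap hf.integrable hK
  trace_preserving := trace_unitaryAverage hf hK
  completelyPositive k M hM := by
    refine posSemidef_matIntegral (F := fun t => ampliation (fun X => (f t : ℂ) •
      (NormedSpace.exp (-(Complex.I * t) • K) * X * NormedSpace.exp ((Complex.I * t) • K))) k M)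
      (fun p q => integrable_unitaryAverage hf.integrable hK _ _ _) fun t => ?_
    have h := posSemidef_ampliation_conj (NormedSpace.exp (-(Complex.I * t) • K)) k hM
    rw [conjTranspose_exp_smul hK] at h
    have hstar : star (-(Complex.I * t)) = Complex.I * t := by simp
    rw [hstar] at h
    exact h.smul (show (0 : ℂ) ≤ f t by exact_mod_cast hf.nonneg t)

end

lemma isHermitian_half_smul {n : Type*} {L : Matrix n n ℂ} (hL : L.IsHermitian) :
    ((1 / 2 : ℂ) • L).IsHermitian := by
  rw [Matrix.IsHermitian, Matrix.conjTranspose_smul, hL.eq]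
  simp

/-! ### The derivative of the matrix exponential and its inverse -/

section
variable {n : Type*} [Fintype n] [DecidableEq n]
open scoped Matrix.Norms.L2Operator

lemma hasFDerivAt_exp_fderiv (A : Matrix n n ℂ) :
    HasFDerivAt (𝕜 := ℂ) NormedSpace.exp (fderiv ℂ NormedSpace.exp A) A :=
  (NormedSpace.exp_analytic (𝕂 := ℂ) A).differentiableAt.hasFDerivAt

lemma fderiv_exp_eq_of_hasDerivAt {A X Y : Matrix n n ℂ}
    (h : HasDerivAt (fun s : ℂ => NormedSpace.exp (A + s • X)) Y 0) :
    fderiv ℂ NormedSpace.exp A X = Y := by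
  have h1 : HasDerivAt (fun s : ℂ => A + s • X) X 0 := by
    simpa using ((hasDerivAt_id (0 : ℂ)).smul_const X).const_add A
  have h2 := (hasFDerivAt_exp_fderiv (A + (0 : ℂ) • X)).comp_hasDerivAt (0 : ℂ) h1
  simp only [zero_smul, add_zero] at h2
  exact h2.unique h

lemma fderiv_exp_of_commute {A X : Matrix n n ℂ} (h : Commute A X) :
    fderiv ℂ NormedSpace.exp A X = NormedSpace.exp A * X := by
  refine fderiv_exp_eq_of_hasDerivAt ?_
  have h1 := (hasDerivAt_exp_smul_const (𝕂 := ℂ) X (0 : ℂ)).const_mul (NormedSpace.exp A)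
  simp only [zero_smul, NormedSpace.exp_zero, one_mul] at h1
  refine h1.congr_of_eventuallyEq (.of_forall fun s => ?_)
  exact Matrix.exp_add_of_commute _ _ (h.smul_right s)

/-- As `a ≠ b` forces `X² = 0`, `A + s X` is the conjugate of `A` by `1 - r X` with `r = s/(a-b)`.
The same conjugation applied to `exp A` gives a formula affine in `s`, so the derivative is read off
exactly. -/
lemma exp_add_smul_of_eigen {A X : Matrix n n ℂ} {a b : ℂ} (ha : A * X = a • X)
    (hb : X * A = b • X) (hab : a ≠ b) (s : ℂ) :
    NormedSpace.exp (A + s • X) =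
      NormedSpace.exp A + (s * ((Complex.exp a - Complex.exp b) / (a - b))) • X := by
  have hab' : a - b ≠ 0 := sub_ne_zero.2 hab
  have hXX : X * X = 0 := by
    have h1 : a • (X * X) = b • (X * X) := by
      rw [← Matrix.mul_smul, ← Matrix.smul_mul, ← ha, ← hb, mul_assoc]
    have h2 : (a - b) • (X * X) = 0 := by rw [sub_smul, h1, sub_self]
    exact (smul_eq_zero.1 h2).resolve_left hab'
  have conj : ∀ (B : Matrix n n ℂ) (c d r : ℂ), B * X = c • X → X * B = d • X →
      (1 - r • X) * B * (1 + r • X) = B + (r * (c - d)) • X := by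
    intro B c d r hc hd
    have h : X * B * X = 0 := by rw [hd, Matrix.smul_mul, hXX, smul_zero]
    simp only [sub_mul, mul_add, one_mul, mul_one, Matrix.smul_mul, Matrix.mul_smul, hc, hd, hXX,
      smul_zero, smul_smul, mul_sub, sub_smul]
    abel
  set r : ℂ := s / (a - b) with hr
  have hinv : (1 - r • X) * (1 + r • X) = 1 := by
    simpa using conj 1 1 1 r (by simp) (by simp)
  have hinv' : (1 + r • X) * (1 - r • X) = 1 := mul_eq_one_comm.1 hinv
  have hexp := Matrix.exp_units_conj (⟨1 - r • X, 1 + r • X, hinv, hinv'⟩ : (Matrix n n ℂ)ˣ) A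
  simp only [Units.inv_mk] at hexp
  rw [conj A a b r ha hb, conj _ _ _ r (exp_mul_of_eigen ha) (mul_exp_of_eigen hb)] at hexp
  rw [show r * (a - b) = s by rw [hr]; field_simp] at hexp
  rw [hexp, hr, div_mul_eq_mul_div, mul_div_assoc]

lemma fderiv_exp_of_eigen_of_ne {A X : Matrix n n ℂ} {a b : ℂ} (ha : A * X = a • X)
    (hb : X * A = b • X) (hab : a ≠ b) :
    fderiv ℂ NormedSpace.exp A X = ((Complex.exp a - Complex.exp b) / (a - b)) • X := by
  refine fderiv_exp_eq_of_hasDerivAt ?_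
  simp_rw [exp_add_smul_of_eigen ha hb hab]
  simpa using (((hasDerivAt_id (0 : ℂ)).mul_const _).smul_const X).const_add (NormedSpace.exp A)

lemma fderiv_exp_of_eigen_of_eq {A X : Matrix n n ℂ} {a : ℂ} (ha : A * X = a • X)
    (hb : X * A = a • X) : fderiv ℂ NormedSpace.exp A X = Complex.exp a • X := by
  rw [fderiv_exp_of_commute (ha.trans hb.symm), exp_mul_of_eigen ha]

lemma induction_linearMap_eq {A : Matrix n n ℂ} (hA : A.IsHermitian) {E : Type*} [AddCommGroup E]
    {F H : Matrix n n ℂ → E} (hF : ∀ X Y, F (X + Y) = F X + F Y)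
    (hH : ∀ X Y, H (X + Y) = H X + H Y)
    (eigen : ∀ (X : Matrix n n ℂ) (a b : ℝ), A * X = (a : ℂ) • X → X * A = (b : ℂ) • X →
      F X = H X) (X : Matrix n n ℂ) : F X = H X := by
  induction X using induction_of_isHermitian hA with
  | zero =>
    have h1 := hF 0 0
    have h2 := hH 0 0
    rw [add_zero, left_eq_add] at h1 h2
    rw [h1, h2]
  | add X Y hX hY => rw [hF, hH, hX, hY]
  | eigen X a b ha hb => exact eigen X a b ha hb

/-- After extracting `e^{-(a+b)/2}`, the sum of exponentials is `2 cosh` and the difference `2 sinh`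
of `(a-b)/2`; their ratio is the `tanh` in the transform. -/
lemma integral_tentDensity_exp (a b : ℝ) :
    ((a : ℂ) - b) * ((Complex.exp (-a) + Complex.exp (-b)) *
      ∫ t : ℝ, (tentDensity t : ℂ) * Complex.exp (-(Complex.I * (a - b : ℝ) * t))) =
    2 * (Complex.exp (-b) - Complex.exp (-a)) := by
  rcases eq_or_ne a b with rfl | hab
  · simp
  rw [fourier_tentDensity (sub_ne_zero.2 hab)]
  have hab' : (a : ℂ) - b ≠ 0 := by exact_mod_cast sub_ne_zero.2 hab
  have hcosh : Complex.cosh ((a - b : ℝ) / 2 : ℂ) ≠ 0 := by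
    have h2 : ((Real.cosh ((a - b) / 2) : ℝ) : ℂ) ≠ 0 := by exact_mod_cast (Real.cosh_pos _).ne'
    simpa using h2
  have e1 : Complex.exp (-a) = Complex.exp (-(a + b) / 2) * Complex.exp (-((a - b : ℝ) / 2)) := by
    rw [← Complex.exp_add]; push_cast; ring_nf
  have e2 : Complex.exp (-b) = Complex.exp (-(a + b) / 2) * Complex.exp ((a - b : ℝ) / 2) := by
    rw [← Complex.exp_add]; push_cast; ring_nf
  have c1 : Complex.exp (-(a : ℂ)) + Complex.exp (-b) =
      Complex.exp (-(a + b) / 2) * (2 * Complex.cosh ((a - b : ℝ) / 2)) := by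
    rw [e1, e2, Complex.two_cosh]; ring
  have c2 : Complex.exp (-(b : ℂ)) - Complex.exp (-a) =
      Complex.exp (-(a + b) / 2) * (2 * Complex.sinh ((a - b : ℝ) / 2)) := by
    rw [e1, e2, Complex.two_sinh]; ring
  rw [c1, c2]
  push_cast at hcosh ⊢
  field_simp

/-- The derivative of the matrix exponential at a Hermitian matrix `-K`, as an anticommutator with
the tent-averaged direction. -/
lemma fderiv_exp_neg {K : Matrix n n ℂ} (hK : K.IsHermitian) (X : Matrix n n ℂ) :
    fderiv ℂ NormedSpace.exp (-K) X =
      (1 / 2 : ℂ) • anticomm (NormedSpace.exp (-K)) (unitaryAverage tentDensity K X) := by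
  have hlin := unitaryAverage_isLinearMap isProbDensity_tentDensity.integrable hK
  refine induction_linearMap_eq hK (F := fun X => fderiv ℂ NormedSpace.exp (-K) X)
    (H := fun X => (1 / 2 : ℂ) • anticomm (NormedSpace.exp (-K)) (unitaryAverage tentDensity K X))
    (fun X Y => map_add _ X Y) (fun X Y => ?_) (fun X a b ha hb => ?_) X
  · simp only [hlin.map_add, anticomm, mul_add, add_mul, smul_add]
    abel
  · have ha' : -K * X = (-a : ℂ) • X := by rw [neg_mul, ha, neg_smul]
    have hb' : X * -K = (-b : ℂ) • X := by rw [mul_neg, hb, neg_smul]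
    simp only [unitaryAverage_of_eigen _ ha hb, anticomm, Matrix.mul_smul, Matrix.smul_mul,
      exp_mul_of_eigen ha', mul_exp_of_eigen hb']
    rw [smul_smul, smul_smul, ← add_smul, smul_smul]
    rcases eq_or_ne a b with rfl | hab
    · rw [fderiv_exp_of_eigen_of_eq ha' hb']
      congr 1
      simp only [sub_self, Complex.ofReal_zero, mul_zero, zero_mul, neg_zero, Complex.exp_zero,
        mul_one]
      rw [integral_complex_ofReal, integral_tentDensity]
      push_cast
      ring
    · have hab' : (a : ℂ) - b ≠ 0 := by exact_mod_cast sub_ne_zero.2 hab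
      have hab'' : (-a : ℂ) - -b ≠ 0 := by
        rw [neg_sub_neg, ← neg_sub]; exact neg_ne_zero.2 hab'
      rw [fderiv_exp_of_eigen_of_ne ha' hb' (sub_ne_zero.1 hab'')]
      congr 1
      have h := integral_tentDensity_exp a b
      rw [div_eq_iff hab'']
      linear_combination (1 / 2 : ℂ) * h

lemma exp_mul_integral_logisticDensity (a b : ℝ) :
    (Complex.exp a - Complex.exp b) * (Complex.exp (-((a + b) / 2)) *
      ∫ t : ℝ, (logisticDensity t : ℂ) * Complex.exp (-(Complex.I * (a / 2 - b / 2 : ℝ) * t))) =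
    a - b := by
  rcases eq_or_ne a b with rfl | hab
  · simp
  have hab' : a / 2 - b / 2 ≠ 0 := fun h => hab (by linarith)
  rw [fourier_logisticDensity hab']
  have hs : Complex.sinh (a / 2 - b / 2 : ℝ) ≠ 0 := by
    rw [← Complex.ofReal_sinh]
    exact_mod_cast fun h => hab' (Real.sinh_eq_zero.1 h)
  have e1 : Complex.exp a * Complex.exp (-((a + b) / 2)) = Complex.exp (a / 2 - b / 2 : ℝ) := by
    rw [← Complex.exp_add]; push_cast; ring_nf
  have e2 : Complex.exp b * Complex.exp (-((a + b) / 2)) = Complex.exp (-(a / 2 - b / 2 : ℝ)) := by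
    rw [← Complex.exp_add]; push_cast; ring_nf
  rw [← mul_assoc, sub_mul, e1, e2, ← Complex.two_sinh, Complex.ofReal_sinh]
  rw [mul_assoc, mul_div_cancel₀ _ hs]
  push_cast
  ring

/-- The inverse of the derivative of the matrix exponential at a Hermitian matrix `L`. -/
def logDerivMap (L X : Matrix n n ℂ) : Matrix n n ℂ :=
  NormedSpace.exp ((-(1 / 2) : ℂ) • L) * unitaryAverage logisticDensity ((1 / 2 : ℂ) • L) X *
    NormedSpace.exp ((-(1 / 2) : ℂ) • L)

lemma logDerivMap_isLinearMap {L : Matrix n n ℂ} (hL : L.IsHermitian) :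
    IsLinearMap ℂ (logDerivMap L) := by
  have hlin := unitaryAverage_isLinearMap integrable_logisticDensity (isHermitian_half_smul hL)
  constructor
  · intro X Y
    simp only [logDerivMap, hlin.map_add, mul_add, add_mul]
  · intro c X
    simp only [logDerivMap, hlin.map_smul, Matrix.mul_smul, Matrix.smul_mul]

/-- On joint eigenvectors the two maps multiply by reciprocal scalars, `(e^a - e^b)/(a - b)` and its
inverse, or `e^a` and `e^{-a}` when `a = b`. -/
lemma logDerivMap_fderiv_exp {L : Matrix n n ℂ} (hL : L.IsHermitian) (X : Matrix n n ℂ) :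
    logDerivMap L (fderiv ℂ NormedSpace.exp L X) = X := by
  have hlin := logDerivMap_isLinearMap hL
  refine induction_linearMap_eq hL
    (F := fun X => logDerivMap L (fderiv ℂ NormedSpace.exp L X)) (H := fun X => X)
    (fun X Y => by simp only [map_add, hlin.map_add]) (fun X Y => rfl) (fun X a b ha hb => ?_) X
  have ha2 : ((1 / 2 : ℂ) • L) * X = ((a / 2 : ℝ) : ℂ) • X := by
    rw [smul_mul_of_eigen _ ha]; push_cast; ring_nf
  have hb2 : X * ((1 / 2 : ℂ) • L) = ((b / 2 : ℝ) : ℂ) • X := by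
    rw [mul_smul_of_eigen _ hb]; push_cast; ring_nf
  have hE : logDerivMap L X = (Complex.exp (-((a + b) / 2)) *
      ∫ t : ℝ, (logisticDensity t : ℂ) *
        Complex.exp (-(Complex.I * (a / 2 - b / 2 : ℝ) * t))) • X := by
    rw [logDerivMap, unitaryAverage_of_eigen _ ha2 hb2, Matrix.mul_smul, Matrix.smul_mul,
      exp_mul_of_eigen (smul_mul_of_eigen _ ha), Matrix.smul_mul,
      mul_exp_of_eigen (mul_smul_of_eigen _ hb), smul_smul, smul_smul, mul_assoc,
      ← Complex.exp_add, mul_comm]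
    congr 3
    ring
  rcases eq_or_ne a b with rfl | hab
  · rw [fderiv_exp_of_eigen_of_eq ha hb, hlin.map_smul, hE, smul_smul]
    simp only [sub_self, Complex.ofReal_zero, mul_zero, zero_mul, neg_zero, Complex.exp_zero,
        mul_one]
    rw [integral_complex_ofReal, integral_logisticDensity, Complex.ofReal_one, mul_one,
      ← Complex.exp_add]
    ring_nf
    simp
  · have hab' : (a : ℂ) - b ≠ 0 := by exact_mod_cast sub_ne_zero.2 hab
    rw [fderiv_exp_of_eigen_of_ne ha hb (sub_ne_zero.1 hab'), hlin.map_smul, hE, smul_smul,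
      div_mul_eq_mul_div, exp_mul_integral_logisticDensity, div_self hab', one_smul]

end

/-! ### Hamiltonians and partial traces -/

lemma isHermitian_ham {n : Type*} {J : ℕ} {G : Fin J → Matrix n n ℂ} (hG : ∀ j, (G j).IsHermitian)
    (θ : Fin J → ℝ) : (ham G θ).IsHermitian := by
  simp [Matrix.IsHermitian, ham, Matrix.conjTranspose_sum, (hG _).eq]

lemma ham_update {n : Type*} {J : ℕ} (G : Fin J → Matrix n n ℂ) (θ : Fin J → ℝ) (j : Fin J)
    (s : ℝ) : ham G (Function.update θ j s) = ham G θ + (s - θ j) • G j := by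
  simp only [ham]
  rw [← Finset.add_sum_erase _ _ (Finset.mem_univ j),
    ← Finset.add_sum_erase _ (fun i => (θ i : ℂ) • G i) (Finset.mem_univ j),
    Finset.sum_congr rfl fun i hi => by rw [Function.update_of_ne (Finset.ne_of_mem_erase hi)],
    Function.update_self, sub_smul]
  simp only [Complex.coe_smul]
  abel

lemma trace_anticomm {n : Type*} [Fintype n] (A B : Matrix n n ℂ) :
    (anticomm A B).trace = 2 * (A * B).trace := by
  rw [anticomm, Matrix.trace_add, Matrix.trace_mul_comm B A, two_mul]

lemma partialTrace_add {v h : Type*} [Fintype h] (M N : Matrix (v × h) (v × h) ℂ) :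
    partialTrace (M + N) = partialTrace M + partialTrace N := by
  ext i j
  simp [partialTrace, Finset.sum_add_distrib]

lemma partialTrace_smul {v h : Type*} [Fintype h] (c : ℂ) (M : Matrix (v × h) (v × h) ℂ) :
    partialTrace (c • M) = c • partialTrace M := by
  ext i j
  simp [partialTrace, Finset.mul_sum]

lemma trace_kronecker_one_mul {v h : Type*} [Fintype v] [Fintype h] [DecidableEq h]
    (R : Matrix v v ℂ) (M : Matrix (v × h) (v × h) ℂ) :
    ((R ⊗ₖ (1 : Matrix h h ℂ)) * M).trace = (R * partialTrace M).trace := by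
  simp only [Matrix.trace, Matrix.diag, Matrix.mul_apply, Fintype.sum_prod_type, partialTrace,
    Matrix.of_apply, Matrix.kroneckerMap_apply, Matrix.one_apply, mul_ite, mul_one, mul_zero,
    ite_mul, zero_mul, Finset.sum_ite_eq, Finset.mem_univ, if_true, Finset.mul_sum]
  exact Finset.sum_congr rfl fun i _ => Finset.sum_comm

lemma posDef_partialTrace {v h : Type*} [Fintype h] [Nonempty h]
    {M : Matrix (v × h) (v × h) ℂ} (hM : M.PosDef) : (partialTrace M).PosDef := by
  have : partialTrace M = ∑ k : h, M.submatrix (fun a => (a, k)) (fun a => (a, k)) := by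
    ext i j
    simp [partialTrace, Matrix.sum_apply]
  rw [this]
  exact Matrix.posDef_sum Finset.univ_nonempty fun k _ =>
    hM.submatrix fun a b hab => (Prod.mk.inj hab).1

/-! ### Derivatives of the matrix logarithm and of the thermal state -/

section
variable {n : Type*} [Fintype n] [DecidableEq n]
open scoped Matrix.Norms.L2Operator MatrixOrder

lemma isHermitian_matLog (A : Matrix n n ℂ) : (matLog A).IsHermitian :=
  (IsSelfAdjoint.log (a := A))

lemma exp_matLog {A : Matrix n n ℂ} (hA : A.PosDef) : NormedSpace.exp (matLog A) = A :=
  CFC.exp_log A hA.isStrictlyPositive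

/-- Inverse function argument: `exp (matLog (S r)) = S r`, `matLog ∘ S` is continuous at `s`, and
`logDerivMap` is a left inverse of the derivative of `exp`. -/
lemma hasDerivAt_matLog {S : ℝ → Matrix n n ℂ} {S' : Matrix n n ℂ} {s : ℝ}
    (hpos : ∀ r, (S r).PosDef) (hS : HasDerivAt S S' s) :
    HasDerivAt (fun r => matLog (S r)) (logDerivMap (matLog (S s)) S') s := by
  have hL := isHermitian_matLog (S s)
  have hcont : ContinuousAt (fun r => matLog (S r)) s := by
    have h1 : ContinuousWithinAt (CFC.log : Matrix n n ℂ → Matrix n n ℂ)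
        {a | IsSelfAdjoint a ∧ IsUnit a} (S s) :=
      CFC.continuousOn_log _ ⟨(hpos s).isHermitian, (hpos s).isUnit⟩
    exact h1.tendsto.comp (tendsto_nhdsWithin_iff.2 ⟨hS.continuousAt,
      .of_forall fun r => ⟨(hpos r).isHermitian, (hpos r).isUnit⟩⟩)
  have hexp := (hasFDerivAt_exp_fderiv (matLog (S s))).restrictScalars ℝ
  let T : Matrix n n ℂ →L[ℝ] Matrix n n ℂ :=
    (LinearMap.toContinuousLinearMap
      ((logDerivMap_isLinearMap hL).mk' (logDerivMap (matLog (S s))))).restrictScalars ℝ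
  have key := HasFDerivAt.of_comp_of_leftInverse (f'symm := T) hcont hexp hS.hasFDerivAt
    (.of_forall fun r => exp_matLog (hpos r)) (fun X => logDerivMap_fderiv_exp hL X)
  have := key.hasDerivAt
  simpa [T] using this

lemma posDef_exp {A : Matrix n n ℂ} (hA : A.IsHermitian) : (NormedSpace.exp A).PosDef := by
  have h := Matrix.isUnit_exp ((1 / 2 : ℂ) • A)
  have h2 := Matrix.PosDef.conjTranspose_mul_self _
    (Matrix.mulVec_injective_of_isUnit h)
  rw [conjTranspose_exp_smul hA, exp_smul_mul_exp_smul] at h2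
  have h3 : star (1 / 2 : ℂ) + 1 / 2 = 1 := by
    rw [star_div₀, star_one, star_ofNat]; norm_num
  rwa [h3, one_smul] at h2

lemma partitionFun_pos [Nonempty n] {J : ℕ} {G : Fin J → Matrix n n ℂ}
    (hG : ∀ j, (G j).IsHermitian) (θ : Fin J → ℝ) : 0 < partitionFun G θ :=
  (posDef_exp (isHermitian_ham hG θ).neg).trace_pos

lemma posDef_thermalState [Nonempty n] {J : ℕ} {G : Fin J → Matrix n n ℂ}
    (hG : ∀ j, (G j).IsHermitian) (θ : Fin J → ℝ) : (thermalState G θ).PosDef :=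
  (posDef_exp (isHermitian_ham hG θ).neg).smul (inv_pos.2 (partitionFun_pos hG θ))

lemma mapPhi_eq_unitaryAverage {J : ℕ} (G : Fin J → Matrix n n ℂ) (θ : Fin J → ℝ) :
    mapPhi G θ = unitaryAverage tentDensity (ham G θ) := rfl

lemma unitaryAverage_exp_neg {f : ℝ → ℝ} (hf : IsProbDensity f) (K : Matrix n n ℂ) :
    unitaryAverage f K (NormedSpace.exp (-K)) = NormedSpace.exp (-K) := by
  have h : ∀ t : ℝ, NormedSpace.exp (-(Complex.I * t) • K) * NormedSpace.exp (-K) *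
      NormedSpace.exp ((Complex.I * t) • K) = NormedSpace.exp (-K) := by
    intro t
    rw [← neg_one_smul ℂ K, exp_smul_mul_exp_smul, exp_smul_mul_exp_smul]
    congr 2
    ring
  ext i j
  simp only [unitaryAverage, matIntegral, h, Matrix.of_apply, Matrix.smul_apply, smul_eq_mul]
  rw [integral_mul_const, integral_complex_ofReal, hf.integral_eq_one]
  simp

lemma hasDerivAt_exp_neg_ham {J : ℕ} {G : Fin J → Matrix n n ℂ}
    (hG : ∀ j, (G j).IsHermitian) (θ : Fin J → ℝ) (j : Fin J) :
    HasDerivAt (fun s => NormedSpace.exp (-ham G (Function.update θ j s)))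
      (-((1 / 2 : ℂ) • anticomm (NormedSpace.exp (-ham G θ)) (mapPhi G θ (G j)))) (θ j) := by
  have h1 : HasDerivAt (fun s : ℝ => -ham G (Function.update θ j s)) (-G j) (θ j) := by
    simp_rw [ham_update]
    simpa using ((((hasDerivAt_id (θ j)).sub_const (θ j)).smul_const (G j)).const_add
      (ham G θ)).fun_neg
  have h2 := ((hasFDerivAt_exp_fderiv (-ham G (Function.update θ j (θ j)))).restrictScalars
    ℝ).comp_hasDerivAt (θ j) h1
  rw [Function.update_eq_self] at h2
  refine h2.congr_deriv ?_
  rw [ContinuousLinearMap.coe_restrictScalars', map_neg, fderiv_exp_neg (isHermitian_ham hG θ),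
    mapPhi_eq_unitaryAverage]

lemma hasDerivAt_partitionFun {J : ℕ} {G : Fin J → Matrix n n ℂ}
    (hG : ∀ j, (G j).IsHermitian) (θ : Fin J → ℝ) (j : Fin J) :
    HasDerivAt (fun s => partitionFun G (Function.update θ j s))
      (-(NormedSpace.exp (-ham G θ) * G j).trace) (θ j) := by
  have h := ((LinearMap.toContinuousLinearMap (Matrix.traceLinearMap n ℂ ℂ)).restrictScalars
    ℝ).hasFDerivAt.comp_hasDerivAt (θ j) (hasDerivAt_exp_neg_ham hG θ j)
  refine h.congr_deriv ?_
  -- The average disappears under the trace: it is symmetric and fixes `e^{-G(θ)}`.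
  have : (anticomm (NormedSpace.exp (-ham G θ)) (mapPhi G θ (G j))).trace =
      2 * (NormedSpace.exp (-ham G θ) * G j).trace := by
    rw [trace_anticomm, mapPhi_eq_unitaryAverage,
      trace_mul_unitaryAverage isProbDensity_tentDensity.integrable tentDensity_neg
        (isHermitian_ham hG θ), unitaryAverage_exp_neg isProbDensity_tentDensity]
  simp [this]

lemma hasDerivAt_thermalState [Nonempty n] {J : ℕ} {G : Fin J → Matrix n n ℂ}
    (hG : ∀ j, (G j).IsHermitian) (θ : Fin J → ℝ) (j : Fin J) :
    HasDerivAt (fun s => thermalState G (Function.update θ j s))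
      (expect (G j) (thermalState G θ) • thermalState G θ -
        (1 / 2 : ℂ) • anticomm (thermalState G θ) (mapPhi G θ (G j))) (θ j) := by
  have hZ : partitionFun G θ ≠ 0 := (partitionFun_pos hG θ).ne'
  have h0 := hasDerivAt_partitionFun hG θ j
  have h1 := h0.fun_inv (by rwa [Function.update_eq_self])
  have h2 := h1.smul (hasDerivAt_exp_neg_ham hG θ j)
  refine h2.congr_deriv ?_
  simp only [Function.update_eq_self]
  rw [expect, Matrix.trace_mul_comm]
  simp only [thermalState, anticomm, Matrix.smul_mul, Matrix.mul_smul, Matrix.trace_smul,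
    smul_eq_mul, neg_neg, smul_neg, smul_add, smul_smul]
  rw [neg_add_eq_sub, show (G j * NormedSpace.exp (-ham G θ)).trace / partitionFun G θ ^ 2 =
    (partitionFun G θ)⁻¹ * (G j * NormedSpace.exp (-ham G θ)).trace * (partitionFun G θ)⁻¹ by
      field_simp, mul_comm (partitionFun G θ)⁻¹ (1 / 2 : ℂ)]

end

/-! ### Symmetry of the logarithmic derivative under the trace -/

section
variable {n : Type*} [Fintype n] [DecidableEq n]

lemma logDerivMap_exp {L : Matrix n n ℂ} (hL : L.IsHermitian) :
    logDerivMap L (NormedSpace.exp L) = 1 := by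
  have h := logDerivMap_fderiv_exp hL 1
  rwa [fderiv_exp_of_commute (Commute.one_right L), mul_one] at h

/-- Both operations act as scalars on the joint eigenvectors of `L`, hence commute. Symmetry of
`logDerivMap` needs this to reorder its factors. -/
lemma unitaryAverage_conj_exp {f : ℝ → ℝ} (hf : Integrable f) {L : Matrix n n ℂ}
    (hL : L.IsHermitian) (c z : ℝ) (X : Matrix n n ℂ) :
    unitaryAverage f ((c : ℂ) • L) (NormedSpace.exp ((z : ℂ) • L) * X *
      NormedSpace.exp ((z : ℂ) • L)) =
    NormedSpace.exp ((z : ℂ) • L) * unitaryAverage f ((c : ℂ) • L) X *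
      NormedSpace.exp ((z : ℂ) • L) := by
  have hcL : ((c : ℂ) • L).IsHermitian := by
    rw [Matrix.IsHermitian, Matrix.conjTranspose_smul, hL.eq]
    simp
  have hlin := unitaryAverage_isLinearMap hf hcL
  refine induction_linearMap_eq hL
    (F := fun X => unitaryAverage f ((c : ℂ) • L) (NormedSpace.exp ((z : ℂ) • L) * X *
      NormedSpace.exp ((z : ℂ) • L)))
    (H := fun X => NormedSpace.exp ((z : ℂ) • L) * unitaryAverage f ((c : ℂ) • L) X *
      NormedSpace.exp ((z : ℂ) • L))
    (fun X Y => by simp only [mul_add, add_mul, hlin.map_add])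
    (fun X Y => by simp only [mul_add, add_mul, hlin.map_add]) (fun X a b ha hb => ?_) X
  have ha2 : ((c : ℂ) • L) * X = ((c * a : ℝ) : ℂ) • X := by
    rw [smul_mul_of_eigen _ ha]; push_cast; rfl
  have hb2 : X * ((c : ℂ) • L) = ((c * b : ℝ) : ℂ) • X := by
    rw [mul_smul_of_eigen _ hb]; push_cast; rfl
  simp only [exp_mul_of_eigen (smul_mul_of_eigen _ ha), Matrix.smul_mul, Matrix.mul_smul,
    mul_exp_of_eigen (mul_smul_of_eigen _ hb), hlin.map_smul, unitaryAverage_of_eigen _ ha2 hb2]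
  simp only [smul_smul]
  congr 1
  ring

lemma trace_mul_logDerivMap {L : Matrix n n ℂ} (hL : L.IsHermitian) (ρ X : Matrix n n ℂ) :
    (ρ * logDerivMap L X).trace = (logDerivMap L ρ * X).trace := by
  have h := unitaryAverage_conj_exp integrable_logisticDensity hL (1 / 2) (-(1 / 2)) ρ
  push_cast at h
  rw [logDerivMap, logDerivMap, ← h, ← trace_mul_unitaryAverage integrable_logisticDensity
    logisticDensity_neg (isHermitian_half_smul hL), ← mul_assoc, ← mul_assoc,
    Matrix.trace_mul_comm, ← mul_assoc, ← mul_assoc]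

lemma trace_anticomm_mul (A B C : Matrix n n ℂ) :
    (anticomm A B * C).trace = (B * anticomm A C).trace := by
  simp only [anticomm, add_mul, mul_add, Matrix.trace_add, mul_assoc]
  rw [add_comm, Matrix.trace_mul_comm A (B * C), mul_assoc]

end

/-! ### The visible marginal, the gradient formula and the map `Ξ` -/

section
variable {v h : Type*} [Fintype v] [DecidableEq v] [Fintype h] [DecidableEq h]
  {J : ℕ} {G : Fin J → Matrix (v × h) (v × h) ℂ}

lemma mapUpsilon_eq_unitaryAverage (θ : Fin J → ℝ) :
    mapUpsilon G θ =
      unitaryAverage logisticDensity ((1 / 2 : ℂ) • matLog (visibleState G θ)) := by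
  ext1 X
  simp only [mapUpsilon, unitaryAverage, matPow, smul_smul]
  congr 1
  ext1 t
  rw [show -(Complex.I * t / 2) = -(Complex.I * t) * (1 / 2) by ring,
    show Complex.I * t / 2 = Complex.I * t * (1 / 2) by ring]

/-- The factors `σ_v^{-1/2}` of `Ξ` around `Υ(ρ)` are exactly those of `logDerivMap` at `ln σ_v`. -/
lemma mapXi_mapUpsilon (θ : Fin J → ℝ) (ρ : Matrix v v ℂ) :
    mapXi G θ (mapUpsilon G θ ρ) = (1 / 2 : ℂ) • anticomm (thermalState G θ)
      (logDerivMap (matLog (visibleState G θ)) ρ ⊗ₖ (1 : Matrix h h ℂ)) := by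
  rw [mapXi, mapUpsilon_eq_unitaryAverage]
  rfl

variable [Nonempty v] [Nonempty h]

lemma posDef_visibleState (hG : ∀ j, (G j).IsHermitian) (θ : Fin J → ℝ) :
    (visibleState G θ).PosDef :=
  posDef_partialTrace (posDef_thermalState hG θ)

open scoped Matrix.Norms.L2Operator in
lemma hasDerivAt_visibleState (hG : ∀ j, (G j).IsHermitian) (θ : Fin J → ℝ) (j : Fin J) :
    HasDerivAt (fun s => visibleState G (Function.update θ j s))
      (expect (G j) (thermalState G θ) • visibleState G θ -
        (1 / 2 : ℂ) • partialTrace (anticomm (thermalState G θ) (mapPhi G θ (G j)))) (θ j) := by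
  let T : Matrix (v × h) (v × h) ℂ →ₗ[ℂ] Matrix v v ℂ :=
    IsLinearMap.mk' partialTrace ⟨partialTrace_add, partialTrace_smul⟩
  have h := ((LinearMap.toContinuousLinearMap T).restrictScalars
    ℝ).hasFDerivAt.comp_hasDerivAt (θ j) (hasDerivAt_thermalState hG θ j)
  refine h.congr_deriv ?_
  change T _ = _
  rw [map_sub, map_smul, map_smul]
  rfl

open scoped Matrix.Norms.L2Operator in
lemma hasDerivAt_relEntropy (hG : ∀ j, (G j).IsHermitian) (θ : Fin J → ℝ) {ρ : Matrix v v ℂ}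
    (hρ : ρ.trace = 1) (j : Fin J) :
    HasDerivAt (fun s : ℝ => relEntropy ρ (visibleState G (Function.update θ j s)))
      (expect (G j) (mapSigma G θ ρ) - expect (G j) (thermalState G θ)) (θ j) := by
  have hlog := hasDerivAt_matLog (fun s => posDef_visibleState hG (Function.update θ j s))
    (hasDerivAt_visibleState hG θ j)
  rw [Function.update_eq_self] at hlog
  have hL := isHermitian_matLog (visibleState G θ)
  have hlin := logDerivMap_isLinearMap hL
  let T : Matrix v v ℂ →ₗ[ℂ] ℂ := (Matrix.traceLinearMap v ℂ ℂ).comp (LinearMap.mulLeft ℂ ρ)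
  have h1 := (((LinearMap.toContinuousLinearMap T).restrictScalars
    ℝ).hasFDerivAt.comp_hasDerivAt (θ j) hlog).const_sub (ρ * matLog ρ).trace
  refine h1.congr_deriv ?_
  change -(ρ * _).trace = _
  have hvis : logDerivMap (matLog (visibleState G θ)) (visibleState G θ) = 1 := by
    simpa only [exp_matLog (posDef_visibleState hG θ)] using logDerivMap_exp hL
  -- Adjoints in turn: `logDerivMap` moves to `ρ`, the partial trace becomes `⊗ 1`, then the
  -- anticommutator and `Φ` move off `G j`.
  rw [hlin.map_sub, hlin.map_smul, hlin.map_smul, hvis, mul_sub, Matrix.mul_smul, Matrix.mul_smul,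
    mul_one, Matrix.trace_sub, Matrix.trace_smul, Matrix.trace_smul, hρ, trace_mul_logDerivMap hL,
    ← trace_kronecker_one_mul, ← trace_anticomm_mul, mapPhi_eq_unitaryAverage,
    trace_mul_unitaryAverage isProbDensity_tentDensity.integrable tentDensity_neg
      (isHermitian_ham hG θ)]
  have hS : expect (G j) (mapSigma G θ ρ) = (1 / 2 : ℂ) * (unitaryAverage tentDensity (ham G θ)
      (anticomm (thermalState G θ) (logDerivMap (matLog (visibleState G θ)) ρ ⊗ₖ
        (1 : Matrix h h ℂ))) * G j).trace := by
    rw [expect, mapSigma, Function.comp_apply, Function.comp_apply, mapXi_mapUpsilon,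
      mapPhi_eq_unitaryAverage, Matrix.trace_mul_comm,
      (unitaryAverage_isLinearMap isProbDensity_tentDensity.integrable
        (isHermitian_ham hG θ)).map_smul, Matrix.smul_mul, Matrix.trace_smul, smul_eq_mul]
  rw [hS]
  simp only [smul_eq_mul, mul_one]
  ring

lemma isHPTP_mapXi (hG : ∀ j, (G j).IsHermitian) (θ : Fin J → ℝ) : IsHPTP (mapXi G θ) where
  linear := by
    constructor
    · intro X Y
      simp only [mapXi, anticomm, mul_add, add_mul, Matrix.add_kronecker, smul_add]
      abel
    · intro c X
      simp only [mapXi, anticomm, Matrix.mul_smul, Matrix.smul_mul, Matrix.smul_kronecker,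
        ← smul_add]
      rw [smul_comm]
  hermiticity_preserving X hX := by
    have hP : (matPow (visibleState G θ) (-(1 / 2))).IsHermitian := by
      rw [Matrix.IsHermitian, matPow, conjTranspose_exp_smul (isHermitian_matLog _)]
      simp
    rw [Matrix.IsHermitian, mapXi, anticomm]
    simp only [Matrix.conjTranspose_smul, Matrix.conjTranspose_add, Matrix.conjTranspose_mul,
      Matrix.conjTranspose_kronecker, hP.eq, hX.eq, (posDef_thermalState hG θ).isHermitian.eq,
      Matrix.conjTranspose_one, mul_assoc]
    rw [add_comm]
    simp
  trace_preserving X := by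
    -- With `σ_v = e^L` the exponents `-1/2 + 1 - 1/2` cancel.
    have hP : matPow (visibleState G θ) (-(1 / 2)) * visibleState G θ *
        matPow (visibleState G θ) (-(1 / 2)) = 1 := by
      have h1 := exp_matLog (posDef_visibleState hG θ)
      set L := matLog (visibleState G θ) with hL
      rw [matPow, ← hL, ← h1]
      conv_lhs => rw [← one_smul ℂ L]
      simp only [smul_smul, exp_smul_mul_exp_smul]
      norm_num
    rw [mapXi, Matrix.trace_smul, trace_anticomm, Matrix.trace_mul_comm, trace_kronecker_one_mul,
      smul_eq_mul, ← mul_assoc, one_div_mul_cancel two_ne_zero, one_mul]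
    change (_ * visibleState G θ).trace = _
    rw [mul_assoc, Matrix.trace_mul_comm, ← mul_assoc, hP, one_mul]

end

end QBM
end

theorem mainTheorem1 {v h : Type*} [Fintype v] [DecidableEq v] [Fintype h] [DecidableEq h]
    [Nonempty v] [Nonempty h] {J : ℕ} (G : Fin J → Matrix (v × h) (v × h) ℂ)
    (hG : ∀ j, (G j).IsHermitian) (θ : Fin J → ℝ) :
    (∀ (ρ : Matrix v v ℂ), QBM.IsState ρ → ∀ j : Fin J,
      HasDerivAt
        (fun s : ℝ => QBM.relEntropy ρ (QBM.visibleState G (Function.update θ j s)))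
        (QBM.expect (G j) (QBM.mapSigma G θ ρ) - QBM.expect (G j) (QBM.thermalState G θ))
        (θ j)) ∧
    QBM.IsHPTP (QBM.mapXi G θ) ∧
    QBM.IsQuantumChannel (QBM.mapPhi G θ) ∧
    QBM.IsQuantumChannel (QBM.mapUpsilon G θ) ∧
    QBM.IsProbDensity QBM.tentDensity ∧
    QBM.IsProbDensity QBM.logisticDensity := by
  refine ⟨fun ρ hρ j => QBM.hasDerivAt_relEntropy hG θ hρ.trace_eq_one j, QBM.isHPTP_mapXi hG θ,
    QBM.isQuantumChannel_unitaryAverage QBM.isProbDensity_tentDensity (QBM.isHermitian_ham hG θ),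
    ?_, QBM.isProbDensity_tentDensity, QBM.isProbDensity_logisticDensity⟩
  rw [QBM.mapUpsilon_eq_unitaryAverage]
  exact QBM.isQuantumChannel_unitaryAverage QBM.isProbDensity_logisticDensity
    (QBM.isHermitian_half_smul (QBM.isHermitian_matLog _))
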